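/- Let $F(t,z)$ be an entire function on $\mathbb{C}^2$ that satisfies the heat equation $\partial_t F=\partial_z^2 F$. The order of an entire function $g:\mathbb{C}\to\mathbb{C}$ is the smallest $\sigma\in[0,\infty]$ such that for every $\varepsilon>0$ one has $|g(\zeta)|\le\exp(|\zeta|^{\sigma+\varepsilon})$ for all sufficiently large $|\zeta|$ (the condition being void for $\sigma=\infty$; constants, including $0$, have order $0$). Then: (i) The order of $F(t,\cdot)$ is the same number $\rho\in[0,2]$ for every $t\in\mathbb{C}$ (the $z$-order of $F$). For $z\in\mathbb{C}$ let $\rho_{t,0}(z)$ and $\rho_{t,1}(z)$ denote the orders of the entire functions $t\mapsto F(t,z)$ and $t\mapsto\partial_zF(t,z)$. The quantity $\rho_t:=\max\{\rho_{t,0}(z),\rho_{t,1}(z)\}\in[0,\infty]$ does not depend on $z$, and $$\rho_t=\frac{\rho}{2-\rho},$$ where the right-hand side is read as $\infty$ when $\rho=2$; in particular, $\rho_t=\infty$ if and only if $\rho=2$, and $\rho_t=0$ if and only if $\rho=0$. (ii) For almost every $z\in\mathbb{C}$ (with respect to Lebesgue measure) $\rho_{t,0}(z)=\rho_t$, and for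 almost every $z\in\mathbb{C}$ $\rho_{t,1}(z)=\rho_t$. -/

import Mathlib

open scoped NNReal ENNReal

/-- The order of an entire function `g` of one complex variable: the smallest exponent `σ ≥ 0` such
that for every `ε > 0` one has `|g z| ≤ exp (|z| ^ (σ + ε))` for all sufficiently large `|z|`
(and `∞` if there is no such exponent). In particular constants, including `0`, have order `0`. -/
noncomputable def entireOrder (g : ℂ → ℂ) : ℝ≥0∞ :=
  sInf {s : ℝ≥0∞ | ∃ σ : ℝ≥0, s = (σ : ℝ≥0∞) ∧
    ∀ ε : ℝ, 0 < ε → ∃ r₀ : ℝ, 0 < r₀ ∧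
      ∀ z : ℂ, r₀ ≤ ‖z‖ → ‖g z‖ ≤ Real.exp (‖z‖ ^ ((σ : ℝ) + ε))}

/-- `F t z` is an entire caloric function: it is entire in `(t, z) ∈ ℂ²` and satisfies the heat
equation `∂_t F = ∂_z² F`. -/
structure IsEntireCaloric (F : ℂ → ℂ → ℂ) : Prop where
  entire : Differentiable ℂ (fun p : ℂ × ℂ => F p.1 p.2)
  heat : ∀ t z : ℂ, deriv (fun s : ℂ => F s z) t = deriv (deriv (fun w : ℂ => F t w)) z

/-- The order of `z ↦ F t z`, for fixed `t`. -/
noncomputable def zOrder (F : ℂ → ℂ → ℂ) (t : ℂ) : ℝ≥0∞ :=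
  entireOrder (fun z : ℂ => F t z)

/-- The order of `t ↦ F t z`, for fixed `z`. -/
noncomputable def tOrder₀ (F : ℂ → ℂ → ℂ) (z : ℂ) : ℝ≥0∞ :=
  entireOrder (fun t : ℂ => F t z)

/-- The order of `t ↦ ∂_z F t z`, for fixed `z`. -/
noncomputable def tOrder₁ (F : ℂ → ℂ → ℂ) (z : ℂ) : ℝ≥0∞ :=
  entireOrder (fun t : ℂ => deriv (fun w : ℂ => F t w) z)

/-! The order `σ` of an entire function is encoded, at any centre, by the growth of its derivatives:
the n-th one is about `exp (γ n log n)` with `γ = 1 - 1/σ` (`HasExpGrowth.norm_iteratedDeriv_le`,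
`HasSeqGrowth.hasExpGrowth`). The heat equation turns the t-derivatives of `F` and `∂_z F` at a
point into the even and the odd z-derivatives there (`iteratedDeriv_t`). Passing to every second
index doubles the exponent, so `1 - 1/ρ_t = 2 (1 - 1/ρ)`, that is, `ρ_t = ρ/(2 - ρ)`; both parities
are needed to recover `ρ`, hence the maximum. As this holds at every pair `(t, z)` and `ρ ↦ ρ/(2 -
ρ)` is injective on `[0, 2]`, neither side depends on the point. Cauchy's estimate in `t` gives
exponents just above 1 for free, whence `ρ ≤ 2`.

For (ii), suppose the derivatives of one parity have too small an exponent on a set of positive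
area. Subharmonicity of `log⁺|f|` spreads the gain to a whole disc
(`exists_lt_norm_le_exp_of_volume_ne_zero`), and Cauchy's estimate there passes it on to the other
parity. Then the z-order would be below `ρ`, a contradiction. -/

open Filter Topology Metric MeasureTheory

/-! ### Caloric functions and their mixed derivatives -/

/-- Separately holomorphic, locally bounded solutions of the heat equation. Unlike
`IsEntireCaloric`, this class is visibly closed under `∂_z`. -/
structure IsSepCaloric (F : ℂ → ℂ → ℂ) : Prop where
  diff_t : ∀ z, Differentiable ℂ (fun t => F t z)
  diff_z : ∀ t, Differentiable ℂ (F t)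
  bdd : ∀ R : ℝ, ∃ M : ℝ, ∀ t z : ℂ, ‖t‖ ≤ R → ‖z‖ ≤ R → ‖F t z‖ ≤ M
  heat : ∀ t z, deriv (fun s => F s z) t = deriv (deriv (F t)) z

theorem IsEntireCaloric.isSepCaloric {F : ℂ → ℂ → ℂ} (hF : IsEntireCaloric F) :
    IsSepCaloric F where
  diff_t z := hF.entire.comp (differentiable_id.prodMk (differentiable_const z))
  diff_z t := hF.entire.comp ((differentiable_const t).prodMk differentiable_id)
  bdd R := by
    obtain ⟨M, hM⟩ := (isCompact_closedBall (0 : ℂ × ℂ) R).exists_bound_of_continuousOn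
      hF.entire.continuous.continuousOn
    refine ⟨M, fun t z ht hz => hM (t, z) ?_⟩
    simp [Prod.norm_def, ht, hz]
  heat := hF.heat

theorem differentiable_iteratedDeriv_complex {f : ℂ → ℂ} (hf : Differentiable ℂ f) (n : ℕ) :
    Differentiable ℂ (iteratedDeriv n f) := by
  induction n with
  | zero => simpa using hf
  | succ n ih => rw [iteratedDeriv_succ]; exact ih.deriv

/-- Two Cauchy estimates, each losing radius 1 (3 to 2 to 1), bound `f''` by the same `M`. The
remainder is thus controlled by a bound on `f` alone, hence uniformly in a parameter. -/
theorem norm_sub_sub_mul_deriv_le {f : ℂ → ℂ} (hf : Differentiable ℂ f) {z h : ℂ} {M : ℝ}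
    (hM : ∀ w ∈ closedBall z 3, ‖f w‖ ≤ M) (hh : ‖h‖ ≤ 1) :
    ‖f (z + h) - f z - h * deriv f z‖ ≤ M * ‖h‖ ^ 2 := by
  have h1 : ∀ w ∈ closedBall z 2, ‖deriv f w‖ ≤ M := fun w hw => by
    have := Complex.norm_deriv_le_of_forall_mem_sphere_norm_le (c := w) (R := 1) (C := M)
      one_pos hf.diffContOnCl (fun u hu => hM u ?_)
    · simpa using this
    · simp only [mem_closedBall, mem_sphere] at *
      linarith [dist_triangle u w z]
  have h2 : ∀ w ∈ closedBall z 1, ‖deriv (deriv f) w‖ ≤ M := fun w hw => by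
    have := Complex.norm_deriv_le_of_forall_mem_sphere_norm_le (c := w) (R := 1) (C := M)
      one_pos hf.deriv.diffContOnCl (fun u hu => h1 u ?_)
    · simpa using this
    · simp only [mem_closedBall, mem_sphere] at *
      linarith [dist_triangle u w z]
  have hM0 : 0 ≤ M := (norm_nonneg _).trans (h2 z (by simp))
  have h3 : ∀ w ∈ closedBall z ‖h‖, ‖deriv f w - deriv f z‖ ≤ M * ‖h‖ := fun w hw => by
    have := (convex_closedBall z 1).norm_image_sub_le_of_norm_deriv_le
      (fun x _ => hf.deriv x) h2 (mem_closedBall_self zero_le_one)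
      (closedBall_subset_closedBall hh hw)
    refine this.trans ?_
    gcongr
    simpa [dist_eq_norm] using hw
  have hd : ∀ w, HasDerivAt (fun w => f w - w * deriv f z) (deriv f w - deriv f z) w := fun w => by
    have := (hf w).hasDerivAt.sub ((hasDerivAt_id w).mul_const (deriv f z))
    rw [one_mul] at this
    exact this
  have h4 := (convex_closedBall z ‖h‖).norm_image_sub_le_of_norm_deriv_le
    (f := fun w => f w - w * deriv f z) (C := M * ‖h‖)
    (fun x _ => (hd x).differentiableAt) (fun x hx => by rw [(hd x).deriv]; exact h3 x hx)
    (mem_closedBall_self (norm_nonneg h)) (y := z + h) (by simp)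
  convert! h4 using 1
  · congr 1; ring
  · simp; ring

namespace IsSepCaloric

variable {F : ℂ → ℂ → ℂ}

/-- By Weierstrass' theorem, this makes `∂_z F` holomorphic in `t` and lets `∂_t` pass to the limit,
so that `∂_t` and `∂_z` commute. -/
theorem tendstoLocallyUniformlyOn_slope (hF : IsSepCaloric F) (z : ℂ) :
    TendstoLocallyUniformlyOn
      (fun (n : ℕ) t => (n + 1 : ℂ) * (F t (z + (n + 1 : ℂ)⁻¹) - F t z))
      (fun t => deriv (F t) z) atTop Set.univ := by
  rw [tendstoLocallyUniformlyOn_iff_forall_isCompact isOpen_univ]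
  intro K _ hK
  obtain ⟨R, hR⟩ := hK.isBounded.exists_norm_le
  obtain ⟨M, hM⟩ := hF.bdd (max R (‖z‖ + 3))
  have hlim : Tendsto (fun n : ℕ => M * (1 / ((n : ℝ) + 1))) atTop (𝓝 0) := by
    simpa using tendsto_one_div_add_atTop_nhds_zero_nat.const_mul M
  rw [Metric.tendstoUniformlyOn_iff]
  intro ε hε
  filter_upwards [hlim.eventually (gt_mem_nhds hε)] with n hn t ht
  refine lt_of_le_of_lt ?_ hn
  have hn0 : (n + 1 : ℂ) ≠ 0 := by exact_mod_cast n.succ_ne_zero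
  have hnn : ‖(n + 1 : ℂ)‖ = n + 1 := by
    rw [← Nat.cast_succ, Complex.norm_natCast]; push_cast; ring
  have key := norm_sub_sub_mul_deriv_le (hF.diff_z t) (z := z) (h := (n + 1 : ℂ)⁻¹) (M := M)
    (fun w hw => hM t w ((hR t ht).trans (le_max_left _ _)) (le_trans ?_ (le_max_right _ _))) ?_
  · have e : (n + 1 : ℂ) * (F t (z + (n + 1 : ℂ)⁻¹) - F t z) - deriv (F t) z =
        (n + 1 : ℂ) * (F t (z + (n + 1 : ℂ)⁻¹) - F t z - (n + 1 : ℂ)⁻¹ * deriv (F t) z) := by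
      field_simp
    rw [dist_comm, dist_eq_norm, e, norm_mul, hnn]
    rw [norm_inv, hnn] at key
    calc _ ≤ ((n : ℝ) + 1) * (M * ((n : ℝ) + 1)⁻¹ ^ 2) := by gcongr
      _ = _ := by field_simp
  · have := norm_le_norm_add_norm_sub' w z
    rw [mem_closedBall, dist_eq_norm] at hw
    linarith
  · rw [norm_inv, hnn]
    exact inv_le_one_of_one_le₀ (by linarith [n.cast_nonneg (α := ℝ)])

theorem deriv_z (hF : IsSepCaloric F) : IsSepCaloric (fun t z => deriv (F t) z) where
  diff_t z := by
    have := (hF.tendstoLocallyUniformlyOn_slope z).differentiableOn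
      (Eventually.of_forall fun n => ?_) isOpen_univ
    · exact differentiableOn_univ.1 this
    · exact (((hF.diff_t _).sub (hF.diff_t z)).const_mul _).differentiableOn
  diff_z t := (hF.diff_z t).deriv
  bdd R := by
    obtain ⟨M, hM⟩ := hF.bdd (R + 1)
    refine ⟨M, fun t z ht hz => ?_⟩
    have := Complex.norm_deriv_le_of_forall_mem_sphere_norm_le (c := z) (R := 1) (C := M)
      one_pos (hF.diff_z t).diffContOnCl (fun u hu => hM t u (by linarith) ?_)
    · simpa using this
    · have := norm_le_norm_add_norm_sub' u z
      rw [mem_sphere, dist_eq_norm] at hu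
      linarith
  heat t z := by
    have h1 := (hF.tendstoLocallyUniformlyOn_slope z).deriv
      (Eventually.of_forall fun n =>
        (((hF.diff_t _).sub (hF.diff_t z)).const_mul _).differentiableOn) isOpen_univ
    -- The t-derivatives of the quotients tend to `∂_t ∂_z F`; they are also the z-difference
    -- quotients of `∂_t F = ∂_z² F`.
    have h2 := h1.tendsto_at (Set.mem_univ t)
    set G : ℂ → ℂ := fun w => deriv (fun s => F s w) t
    have hG : G = deriv (deriv (F t)) := funext fun w => hF.heat t w
    have hGd : HasDerivAt G (deriv G z) z := by
      rw [hG]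
      exact ((hF.diff_z t).deriv.deriv z).hasDerivAt
    have h3 := hGd.tendsto_slope_zero.comp (g := fun h : ℂ => h⁻¹ • (G (z + h) - G z))
      (f := fun n : ℕ => (n + 1 : ℂ)⁻¹) (x := atTop) ?_
    · have h4 := tendsto_nhds_unique h2 (h3.congr fun n => ?_)
      · exact h4.trans (by rw [hG])
      · simp only [Function.comp_apply, inv_inv, smul_eq_mul, G]
        have := ((hF.diff_t (z + (n + 1 : ℂ)⁻¹) t).hasDerivAt.sub
          (hF.diff_t z t).hasDerivAt).const_mul (n + 1 : ℂ)
        exact this.deriv.symm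
    · rw [tendsto_nhdsWithin_iff]
      refine ⟨?_, Eventually.of_forall fun n => ?_⟩
      · simpa using tendsto_one_div_add_atTop_nhds_zero_nat (𝕜 := ℂ)
      · simpa using (by exact_mod_cast n.succ_ne_zero : (n + 1 : ℂ) ≠ 0)

theorem iteratedDeriv_t (n : ℕ) (hF : IsSepCaloric F) (t z : ℂ) :
    iteratedDeriv n (fun s => F s z) t = iteratedDeriv (2 * n) (F t) z := by
  induction n generalizing F with
  | zero => simp
  | succ n ih =>
    rw [iteratedDeriv_succ', show 2 * (n + 1) = 2 * n + 1 + 1 by ring, iteratedDeriv_succ',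
      iteratedDeriv_succ', ← ih hF.deriv_z.deriv_z]
    congr 1
    exact funext fun s => hF.heat s z

theorem iteratedDeriv_t_deriv_z (hF : IsSepCaloric F) (n : ℕ) (t z : ℂ) :
    iteratedDeriv n (fun s => deriv (F s) z) t = iteratedDeriv (2 * n + 1) (F t) z := by
  rw [iteratedDeriv_t n hF.deriv_z, iteratedDeriv_succ']

end IsSepCaloric

/-! ### Growth exponents of functions and of sequences -/

/-- `|g z| ≤ exp (|z| ^ s)` for all sufficiently large `|z|`. -/
def HasExpGrowth (g : ℂ → ℂ) (s : ℝ) : Prop :=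
  ∃ r₀ : ℝ, 0 < r₀ ∧ ∀ z : ℂ, r₀ ≤ ‖z‖ → ‖g z‖ ≤ Real.exp (‖z‖ ^ s)

theorem HasExpGrowth.mono {g : ℂ → ℂ} {s s' : ℝ} (h : HasExpGrowth g s) (hs : s ≤ s') :
    HasExpGrowth g s' := by
  obtain ⟨r, _, hr⟩ := h
  refine ⟨max r 1, by positivity, fun z hz => (hr z (le_of_max_le_left hz)).trans ?_⟩
  exact Real.exp_le_exp.2 (Real.rpow_le_rpow_of_exponent_le (le_of_max_le_right hz) hs)

theorem entireOrder_le_iff {g : ℂ → ℂ} {τ : ℝ≥0} :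
    entireOrder g ≤ τ ↔ ∀ s : ℝ, τ < s → HasExpGrowth g s := by
  constructor
  · intro h s hs
    have h1 : entireOrder g < ENNReal.ofReal s :=
      h.trans_lt (by rw [← ENNReal.ofReal_coe_nnreal];
                     exact (ENNReal.ofReal_lt_ofReal_iff (τ.2.trans_lt hs)).2 hs)
    obtain ⟨_, ⟨σ, rfl, hσ⟩, hlt⟩ := sInf_lt_iff.1 h1
    rw [← ENNReal.ofReal_coe_nnreal, ENNReal.ofReal_lt_ofReal_iff (τ.2.trans_lt hs)] at hlt
    have := hσ (s - σ) (sub_pos.2 hlt)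
    rwa [add_sub_cancel] at this
  · intro h
    exact sInf_le ⟨τ, rfl, fun ε hε => h (τ + ε) (by linarith)⟩

/-- `|b n| ≤ exp (γ n log n)` for all sufficiently large `n`. -/
def HasSeqGrowth (b : ℕ → ℂ) (γ : ℝ) : Prop :=
  ∀ᶠ n : ℕ in atTop, ‖b n‖ ≤ Real.exp (γ * (n * Real.log n))

theorem tendsto_log_natCast_atTop : Tendsto (fun n : ℕ => Real.log n) atTop atTop :=
  Real.tendsto_log_atTop.comp tendsto_natCast_atTop_atTop

/-- Any strict loss in the exponent absorbs factors `exp (K n)`; this is why exponents are always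
compared by strict inequalities below. -/
theorem eventually_mul_log_add_le {c d : ℝ} (K : ℝ) (h : c < d) :
    ∀ᶠ n : ℕ in atTop,
      c * (n * Real.log n) + K * n ≤ d * (n * Real.log n) := by
  filter_upwards [tendsto_log_natCast_atTop.eventually_ge_atTop (K / (d - c))] with n hn
  rw [div_le_iff₀ (sub_pos.2 h)] at hn
  nlinarith [n.cast_nonneg (α := ℝ)]

theorem eventually_mul_log_pos : ∀ᶠ n : ℕ in atTop, 0 < n * Real.log n := by
  filter_upwards [tendsto_log_natCast_atTop.eventually_gt_atTop 0, eventually_gt_atTop 0]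
    with n h1 h2
  have : (0 : ℝ) < n := by exact_mod_cast h2
  positivity

/-- Along a progression of step `p` the exponent is multiplied by `p`, and the offset `j` does not
matter. -/
theorem tendsto_mul_log_affine_div {p : ℕ} (hp : 0 < p) (j : ℕ) :
    Tendsto (fun m : ℕ => (((p * m + j : ℕ) : ℝ) * Real.log ((p * m + j : ℕ) : ℝ)) /
      (m * Real.log m)) atTop (𝓝 p) := by
  have h1 : Tendsto (fun m : ℕ => (p : ℝ) + j * (1 / (m : ℝ))) atTop (𝓝 p) := by
    simpa using (tendsto_one_div_atTop_nhds_zero_nat (𝕜 := ℝ)).const_mul (j : ℝ) |>.const_add (p : ℝ)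
  have hp' : (p : ℝ) ≠ 0 := by exact_mod_cast hp.ne'
  have h2 := (h1.log hp').div_atTop tendsto_log_natCast_atTop
  have h3 := h1.mul (h2.const_add 1)
  rw [add_zero, mul_one] at h3
  refine h3.congr' ?_
  filter_upwards [tendsto_log_natCast_atTop.eventually_gt_atTop 0, eventually_gt_atTop 0]
    with m hm hm0
  have hm0' : (0 : ℝ) < m := by exact_mod_cast hm0
  have hpp : (0 : ℝ) < p := by exact_mod_cast hp
  have e : ((p * m + j : ℕ) : ℝ) = m * (p + j * (1 / (m : ℝ))) := by
    push_cast; field_simp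
  rw [e, Real.log_mul hm0'.ne' (by positivity)]
  field_simp

theorem eventually_mul_log_affine_le {p : ℕ} (hp : 0 < p) (j : ℕ) {A B : ℝ} (h : p * B < A) :
    ∀ᶠ m : ℕ in atTop,
      B * (((p * m + j : ℕ) : ℝ) * Real.log ((p * m + j : ℕ) : ℝ)) ≤ A * (m * Real.log m) := by
  have := (tendsto_mul_log_affine_div hp j).const_mul B
  rw [mul_comm] at h
  filter_upwards [this.eventually (gt_mem_nhds h), eventually_mul_log_pos] with m hm hm0
  rw [← mul_div_assoc, div_lt_iff₀ hm0] at hm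
  exact hm.le

theorem eventually_le_mul_log_affine {p : ℕ} (hp : 0 < p) (j : ℕ) {A B : ℝ} (h : A < p * B) :
    ∀ᶠ m : ℕ in atTop,
      A * (m * Real.log m) ≤ B * (((p * m + j : ℕ) : ℝ) * Real.log ((p * m + j : ℕ) : ℝ)) := by
  filter_upwards [eventually_mul_log_affine_le hp j (A := -A) (B := -B) (by linarith)] with m hm
  linarith

theorem HasSeqGrowth.comp_affine {b : ℕ → ℂ} {γ γ' : ℝ} (h : HasSeqGrowth b γ) {p : ℕ}
    (hp : 0 < p) (j : ℕ) (hγ : p * γ < γ') : HasSeqGrowth (fun n => b (p * n + j)) γ' := by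
  have ht : Tendsto (fun n : ℕ => p * n + j) atTop atTop :=
    tendsto_atTop_mono (fun n => (Nat.le_mul_of_pos_left n hp).trans (Nat.le_add_right _ _))
      tendsto_id
  filter_upwards [ht.eventually h, eventually_mul_log_affine_le hp j hγ] with n h1 h2
  exact h1.trans (Real.exp_le_exp.2 h2)

theorem HasSeqGrowth.of_even_odd {b : ℕ → ℂ} {γ γ' : ℝ}
    (h0 : HasSeqGrowth (fun n => b (2 * n)) γ) (h1 : HasSeqGrowth (fun n => b (2 * n + 1)) γ)
    (hγ : γ < 2 * γ') : HasSeqGrowth b γ' := by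
  have e0 := h0.and (eventually_le_mul_log_affine two_pos 0 (A := γ) (B := γ') (by simpa using hγ))
  have e1 := h1.and (eventually_le_mul_log_affine two_pos 1 (A := γ) (B := γ') (by simpa using hγ))
  obtain ⟨N, hN⟩ := eventually_atTop.1 (e0.and e1)
  refine eventually_atTop.2 ⟨2 * N, fun n hn => ?_⟩
  obtain ⟨⟨a1, a2⟩, b1, b2⟩ := hN (n / 2) (by omega)
  rcases Nat.even_or_odd' n with ⟨k, rfl | rfl⟩
  · rw [show 2 * k / 2 = k by omega] at a1 a2
    exact a1.trans (Real.exp_le_exp.2 a2)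
  · rw [show (2 * k + 1) / 2 = k by omega] at b1 b2
    exact b1.trans (Real.exp_le_exp.2 b2)

theorem HasSeqGrowth.of_succ {b : ℕ → ℂ} {γ γ' : ℝ} (h : HasSeqGrowth (fun n => b (n + 1)) γ)
    (hγ : γ < γ') : HasSeqGrowth b γ' := by
  have e := h.and (eventually_le_mul_log_affine one_pos 1 (A := γ) (B := γ') (by simpa using hγ))
  obtain ⟨N, hN⟩ := eventually_atTop.1 e
  refine eventually_atTop.2 ⟨N + 1, fun n hn => ?_⟩
  obtain ⟨k, rfl⟩ : ∃ k, n = k + 1 := ⟨n - 1, by omega⟩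
  obtain ⟨a1, a2⟩ := hN k (by omega)
  rw [one_mul] at a2
  exact a1.trans (Real.exp_le_exp.2 a2)

/-! ### Order in terms of Taylor coefficients -/

theorem factorial_le_exp {n : ℕ} (hn : 0 < n) : (n.factorial : ℝ) ≤ Real.exp (n * Real.log n) := by
  rw [mul_comm, Real.exp_mul, Real.exp_log (by exact_mod_cast hn), Real.rpow_natCast]
  exact_mod_cast n.factorial_le_pow

theorem exp_le_factorial {n : ℕ} (hn : 0 < n) :
    Real.exp (n * Real.log n - n) ≤ n.factorial := by
  have h := Real.pow_div_factorial_le_exp (n : ℝ) n.cast_nonneg n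
  rw [div_le_iff₀ (by positivity)] at h
  rw [Real.exp_sub, div_le_iff₀ (Real.exp_pos _), mul_comm (n : ℝ), Real.exp_mul,
    Real.exp_log (by exact_mod_cast hn), Real.rpow_natCast]
  linarith

/-- Cauchy's estimate on the circle of radius `n ^ (1/s)`, where `g` is only `exp (O(n))`: the main
factor is `n! / n ^ (n/s)`. Uniformity in the centre is needed for the area argument. -/
theorem HasExpGrowth.norm_iteratedDeriv_le {g : ℂ → ℂ} (hg : Differentiable ℂ g) {s : ℝ}
    (h : HasExpGrowth g s) (hs : 0 < s) {γ : ℝ} (hγ : 1 - 1 / s < γ) (R : ℝ) :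
    ∀ᶠ n : ℕ in atTop, ∀ c : ℂ, ‖c‖ ≤ R →
      ‖iteratedDeriv n g c‖ ≤ Real.exp (γ * (n * Real.log n)) := by
  obtain ⟨r₀, hr₀, hr⟩ := h
  have ht : Tendsto (fun n : ℕ => (n : ℝ) ^ (1 / s)) atTop atTop :=
    (tendsto_rpow_atTop (by positivity)).comp tendsto_natCast_atTop_atTop
  -- The radius is at least `r₀ + |R|`, so the circle stays outside the disc where the growth bound
  -- may fail.
  filter_upwards [ht.eventually_ge_atTop (r₀ + |R|), eventually_gt_atTop 0,
    eventually_mul_log_add_le (2 ^ s) hγ] with n hn hn0 hlog c hc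
  have hn0' : (0 : ℝ) < n := by exact_mod_cast hn0
  set r := (n : ℝ) ^ (1 / s) with hrdef
  have hrpos : 0 < r := by positivity
  have hcR : ‖c‖ ≤ |R| := hc.trans (le_abs_self R)
  have key := Complex.norm_iteratedDeriv_le_of_forall_mem_sphere_norm_le (c := c) n hrpos
    hg.diffContOnCl (C := Real.exp (2 ^ s * n)) (fun w hw => ?_)
  · refine key.trans ?_
    have hrn : r ^ n = Real.exp (1 / s * (n * Real.log n)) := by
      rw [← Real.exp_log (pow_pos hrpos n), Real.log_pow, hrdef, Real.log_rpow hn0']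
      ring_nf
    rw [hrn, div_le_iff₀ (Real.exp_pos _), ← Real.exp_add]
    refine (mul_le_mul_of_nonneg_right (factorial_le_exp hn0) (Real.exp_pos _).le).trans ?_
    rw [← Real.exp_add]
    refine Real.exp_le_exp.2 ?_
    linarith
  · rw [mem_sphere, dist_eq_norm] at hw
    have h1 : ‖w‖ ≤ 2 * r := by
      have := norm_le_norm_add_norm_sub' w c
      linarith
    have h2 : r₀ ≤ ‖w‖ := by
      have := norm_le_norm_add_norm_sub c (c - w)
      have h3 := norm_sub_le w c
      linarith
    refine (hr w h2).trans (Real.exp_le_exp.2 ?_)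
    calc ‖w‖ ^ s ≤ (2 * r) ^ s := Real.rpow_le_rpow (norm_nonneg _) h1 hs.le
      _ = 2 ^ s * n := by
        rw [Real.mul_rpow zero_le_two hrpos.le, hrdef, ← Real.rpow_mul hn0'.le,
          one_div_mul_cancel hs.ne', Real.rpow_one]

theorem HasSeqGrowth.norm_div_factorial_le {b : ℕ → ℂ} {γ δ : ℝ} (h : HasSeqGrowth b γ)
    (hδ : δ < 1 - γ) :
    ∀ᶠ n : ℕ in atTop, ‖b n‖ / n.factorial ≤ Real.exp (-δ * (n * Real.log n)) := by
  filter_upwards [h, eventually_gt_atTop 0,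
    eventually_mul_log_add_le (c := γ + δ) (d := 1) 1 (by linarith)] with n h1 hn hlog
  rw [div_le_iff₀ (by positivity)]
  refine h1.trans ?_
  refine le_trans ?_ (mul_le_mul_of_nonneg_left (exp_le_factorial hn) (Real.exp_pos _).le)
  rw [← Real.exp_add]
  refine Real.exp_le_exp.2 ?_
  linarith

theorem norm_le_of_taylor_bound {g : ℂ → ℂ} (hg : Differentiable ℂ g) (c z : ℂ) {x B : ℝ}
    (hx : 2 * ‖z - c‖ ≤ x)
    (h : ∀ n : ℕ, ‖iteratedDeriv n g c‖ / n.factorial * x ^ n ≤ B) : ‖g z‖ ≤ 2 * B := by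
  have hs := Complex.hasSum_taylorSeries_of_entire hg c z
  have hgeo : HasSum (fun n : ℕ => B * (1 / 2 : ℝ) ^ n) (2 * B) := by
    rw [mul_comm 2 B]; exact hasSum_geometric_two.mul_left B
  rw [← hs.tsum_eq]
  refine tsum_of_norm_bounded hgeo fun n => ?_
  have e : ‖((n.factorial : ℂ))⁻¹ • (z - c) ^ n • iteratedDeriv n g c‖ =
      ‖iteratedDeriv n g c‖ / n.factorial * ‖z - c‖ ^ n := by
    simp; ring
  rw [e]
  have h1 : ‖z - c‖ ^ n ≤ x ^ n * (1 / 2) ^ n := by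
    rw [← mul_pow]
    exact pow_le_pow_left₀ (norm_nonneg _) (by linarith) n
  calc _ ≤ ‖iteratedDeriv n g c‖ / n.factorial * (x ^ n * (1 / 2) ^ n) := by gcongr
    _ = (‖iteratedDeriv n g c‖ / n.factorial * x ^ n) * (1 / 2) ^ n := by ring
    _ ≤ _ := by gcongr; exact h n

theorem eventually_const_add_rpow_mul_log_le {a s : ℝ} (ha : 0 < a) (has : a < s) (C : ℝ) {ε : ℝ}
    (hε : 0 < ε) : ∀ᶠ x : ℝ in atTop, C + x ^ a * Real.log x ≤ ε * x ^ s := by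
  have h1 := (isLittleO_log_rpow_atTop (sub_pos.2 has)).bound (half_pos hε)
  have h2 := (tendsto_rpow_atTop (ha.trans has)).eventually_ge_atTop (C / (ε / 2))
  filter_upwards [h1, h2, eventually_gt_atTop 1] with x h1 h2 hx
  have hx0 : 0 < x := by linarith
  rw [div_le_iff₀ (by positivity)] at h2
  rw [Real.norm_of_nonneg (Real.log_nonneg hx.le), Real.norm_of_nonneg (by positivity)] at h1
  have h3 : x ^ a * Real.log x ≤ x ^ a * (ε / 2 * x ^ (s - a)) := by gcongr
  have h4 : x ^ a * x ^ (s - a) = x ^ s := by rw [← Real.rpow_add hx0]; ring_nf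
  have h5 : x ^ a * (ε / 2 * x ^ (s - a)) = ε / 2 * x ^ s := by rw [← h4]; ring
  linarith

/-- With coefficients at most `n ^ (-n/a)`, the terms with `n > x ^ a` are at most 1 and the others
at most `C x ^ (x ^ a)`; since `a < s`, this is below `exp (ε x ^ s)`. -/
theorem HasSeqGrowth.hasExpGrowth {g : ℂ → ℂ} (hg : Differentiable ℂ g) {c : ℂ} {γ s : ℝ}
    (h : HasSeqGrowth (fun n => iteratedDeriv n g c) γ) (hγ : γ < 1) (hs : 1 / (1 - γ) < s) :
    HasExpGrowth g s := by
  obtain ⟨a, ha1, has⟩ := exists_between hs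
  have h1γ : 0 < 1 - γ := by linarith
  have ha : 0 < a := lt_trans (by positivity) ha1
  have hδ : 1 / a < 1 - γ := by rwa [one_div_lt ha h1γ]
  obtain ⟨N, hN⟩ := eventually_atTop.1 (h.norm_div_factorial_le hδ)
  obtain ⟨C, hC⟩ : ∃ C : ℝ, 1 ≤ C ∧ ∀ n : ℕ, ‖iteratedDeriv n g c‖ / n.factorial ≤ C := by
    refine ⟨1 + ∑ n ∈ Finset.range N, ‖iteratedDeriv n g c‖ / n.factorial, ?_, fun n => ?_⟩
    · have : 0 ≤ ∑ n ∈ Finset.range N, ‖iteratedDeriv n g c‖ / n.factorial := by positivity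
      linarith
    · by_cases hn : n < N
      · have := Finset.single_le_sum (f := fun n : ℕ => ‖iteratedDeriv n g c‖ / n.factorial)
          (fun i _ => by positivity) (Finset.mem_range.2 hn)
        linarith
      · have h2 := hN n (not_lt.1 hn)
        have h3 : Real.exp (-(1 / a) * (n * Real.log n)) ≤ 1 := by
          rw [Real.exp_le_one_iff]
          have := Real.log_natCast_nonneg n
          have : 0 ≤ 1 / a * (n * Real.log n) := by positivity
          linarith
        have h4 : 0 ≤ ∑ n ∈ Finset.range N, ‖iteratedDeriv n g c‖ / n.factorial := by positivity
        linarith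
  obtain ⟨hC1, hC⟩ := hC
  have hC0 : 0 < C := by linarith
  have hterm : ∀ x : ℝ, 1 ≤ x → (N : ℝ) + 1 ≤ x ^ a → ∀ n : ℕ,
      ‖iteratedDeriv n g c‖ / n.factorial * x ^ n ≤ C * x ^ (x ^ a) := by
    intro x hx hxN n
    have hx0 : 0 < x := by linarith
    have hone : 1 ≤ x ^ (x ^ a) := Real.one_le_rpow hx (by positivity)
    by_cases hn : (n : ℝ) ≤ x ^ a
    · have : x ^ n ≤ x ^ (x ^ a) := by
        rw [← Real.rpow_natCast]; exact Real.rpow_le_rpow_of_exponent_le hx hn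
      gcongr
      exact hC n
    · rw [not_le] at hn
      have hNn : N ≤ n := by
        have : (N : ℝ) < n := by linarith
        exact_mod_cast this.le
      have hn0 : (0 : ℝ) < n := lt_trans (by positivity) hn
      have h2 := hN n hNn
      have h3 : Real.log x ≤ 1 / a * Real.log n := by
        have := Real.log_le_log (by positivity) hn.le
        rw [Real.log_rpow hx0] at this
        rw [one_div, inv_mul_eq_div, le_div_iff₀ ha]
        linarith
      calc _ ≤ Real.exp (-(1 / a) * (n * Real.log n)) * x ^ n := by gcongr
        _ = Real.exp (-(1 / a) * (n * Real.log n) + n * Real.log x) := by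
          rw [Real.exp_add, Real.exp_nat_mul, Real.exp_log hx0]
        _ ≤ 1 := by
          rw [Real.exp_le_one_iff]
          nlinarith [mul_le_mul_of_nonneg_left h3 hn0.le]
        _ ≤ _ := by nlinarith
  -- The factor `(1/4) ^ s` offsets the choice `x = 4‖z‖`, which dominates `2‖z - c‖` once `‖c‖ ≤
  -- ‖z‖`.
  have hev1 := eventually_const_add_rpow_mul_log_le ha has (Real.log (2 * C))
    (ε := (1 / 4) ^ s) (by positivity)
  have hev2 := (tendsto_rpow_atTop ha).eventually_ge_atTop ((N : ℝ) + 1)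
  obtain ⟨X, hX⟩ := eventually_atTop.1 (hev1.and (hev2.and (eventually_ge_atTop 1)))
  refine ⟨max (max X ‖c‖) 1, by positivity, fun z hz => ?_⟩
  have hz1 : X ≤ ‖z‖ := (le_max_left _ _).trans (le_of_max_le_left hz)
  have hz2 : ‖c‖ ≤ ‖z‖ := (le_max_right _ _).trans (le_of_max_le_left hz)
  have hz3 : 1 ≤ ‖z‖ := le_of_max_le_right hz
  obtain ⟨e1, e2, e3⟩ := hX (4 * ‖z‖) (by linarith)
  have hb := norm_le_of_taylor_bound hg c z (x := 4 * ‖z‖) (by linarith [norm_sub_le z c])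
    (hterm _ e3 e2)
  refine hb.trans ?_
  have h4 : (0 : ℝ) < 4 * ‖z‖ := by linarith
  calc 2 * (C * (4 * ‖z‖) ^ ((4 * ‖z‖) ^ a))
      = Real.exp (Real.log (2 * C) + (4 * ‖z‖) ^ a * Real.log (4 * ‖z‖)) := by
        rw [Real.exp_add, Real.exp_log (by positivity), mul_comm (_ ^ a), Real.exp_mul,
          Real.exp_log h4]; ring
    _ ≤ _ := by
      refine Real.exp_le_exp.2 (e1.trans_eq ?_)
      rw [← Real.mul_rpow (by norm_num) h4.le]
      congr 1; ring

/-! ### Subharmonicity of `log⁺|f|` and a two-constants estimate -/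

/-- Jensen's formula, in which the zeros contribute nonnegatively; when `‖f c‖ ≤ 1` the left side is
0. -/
theorem posLog_norm_le_circleAverage {f : ℂ → ℂ} (hf : Differentiable ℂ f) (c : ℂ) {R : ℝ}
    (hR : 0 < R) :
    Real.posLog ‖f c‖ ≤ Real.circleAverage (fun z => Real.posLog ‖f z‖) c R := by
  have hnn : 0 ≤ Real.circleAverage (fun z => Real.posLog ‖f z‖) c R :=
    Real.circleAverage_nonneg_of_nonneg fun _ _ => Real.posLog_nonneg
  by_cases h1 : |‖f c‖| ≤ 1
  · rwa [(Real.posLog_eq_zero_iff _).2 h1]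
  have h1' : 1 < ‖f c‖ := by simpa using h1
  have hfc : f c ≠ 0 := fun h => by simp [h] at h1'; linarith
  have hA : AnalyticOnNhd ℂ f (closedBall c |R|) := fun z _ => hf.analyticAt z
  have hM : MeromorphicOn f (sphere c |R|) := fun z _ => (hf.analyticAt z).meromorphicAt
  rw [Real.posLog_eq_log (by simpa using h1'.le)]
  have hJ := AnalyticOnNhd.circleAverage_log_norm hR.ne' hA hfc
  have hsum : 0 ≤ ∑ᶠ u, (MeromorphicOn.divisor f (closedBall c |R|) u : ℝ) *
      Real.log (R * ‖c - u‖⁻¹) := by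
    refine finsum_nonneg fun u => ?_
    by_cases hu : u ∈ closedBall c |R|
    · refine mul_nonneg (mod_cast MeromorphicOn.AnalyticOnNhd.divisor_nonneg hA u) ?_
      by_cases huc : c = u
      · simp [huc]
      · refine Real.log_nonneg ?_
        have : 0 < ‖c - u‖ := norm_pos_iff.2 (sub_ne_zero.2 huc)
        rw [← div_eq_mul_inv, one_le_div this]
        rwa [mem_closedBall', dist_eq_norm, abs_of_pos hR] at hu
    · simp [hu]
  calc Real.log ‖f c‖ ≤ Real.circleAverage (fun z => Real.log ‖f z‖) c R := by linarith
    _ ≤ _ := Real.circleAverage_mono hM.circleIntegrable_log_norm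
        hM.circleIntegrable_posLog_norm fun z _ => le_max_right _ _

theorem ofReal_mul_volume_le_lintegral_arc {u : ℂ → ℝ} (hu : Continuous u) (hu0 : ∀ z, 0 ≤ u z)
    {c : ℂ} {r : ℝ} (h : u c ≤ Real.circleAverage u c r) :
    ENNReal.ofReal (u c) * volume (Set.Ioo (-Real.pi) Real.pi) ≤
      ∫⁻ θ in Set.Ioo (-Real.pi) Real.pi,
        ENNReal.ofReal (u (c + Complex.polarCoord.symm (r, θ))) := by
  have hcont : Continuous fun θ : ℝ => u (circleMap c r θ) := hu.comp (continuous_circleMap c r)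
  have e : ∀ θ : ℝ, c + Complex.polarCoord.symm (r, θ) = circleMap c r θ := fun θ => by
    simp [circleMap, Complex.exp_mul_I]
  simp_rw [e]
  have hint : IntegrableOn (fun θ : ℝ => u (circleMap c r θ)) (Set.Ioo (-Real.pi) Real.pi) :=
    (hcont.integrableOn_Icc).mono_set Set.Ioo_subset_Icc_self
  rw [← ofReal_integral_eq_lintegral_ofReal hint (Eventually.of_forall fun _ => hu0 _),
    Real.volume_Ioo, ← ENNReal.ofReal_mul (hu0 c)]
  refine ENNReal.ofReal_le_ofReal ?_
  rw [← integral_Ioc_eq_integral_Ioo, ← intervalIntegral.integral_of_le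
    (by linarith [Real.pi_pos])]
  have := Real.circleAverage_eq_integral_add (f := u) (c := c) (R := r) (-Real.pi)
  rw [intervalIntegral.integral_comp_add_right (fun θ => u (circleMap c r θ)), zero_add,
    show 2 * Real.pi + -Real.pi = Real.pi by ring, smul_eq_mul] at this
  rw [this, inv_mul_eq_div, le_div_iff₀ (by linarith [Real.pi_pos])] at h
  linarith

/-- Integration of the circle inequality over the radii, in polar coordinates about `c`. -/
theorem ofReal_mul_volume_ball_le_lintegral {u : ℂ → ℝ} (hu : Continuous u) (hu0 : ∀ z, 0 ≤ u z)
    {c : ℂ} {R : ℝ} (h : ∀ r, 0 < r → u c ≤ Real.circleAverage u c r) :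
    ENNReal.ofReal (u c) * volume (ball c R) ≤ ∫⁻ z in ball c R, ENNReal.ofReal (u z) := by
  have hball : ∀ p : ℝ × ℝ, 0 < p.1 →
      (c + Complex.polarCoord.symm p ∈ ball c R ↔ p.1 < R) := fun p hp => by
    rw [mem_ball, dist_eq_norm, add_sub_cancel_left, Complex.norm_polarCoord_symm, abs_of_pos hp]
  have polar : ∀ U : ℂ → ℝ≥0∞, Measurable U → ∫⁻ z in ball c R, U z =
      ∫⁻ r in Set.Ioi (0 : ℝ), ∫⁻ θ in Set.Ioo (-Real.pi) Real.pi, ENNReal.ofReal r *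
        (ball c R).indicator U (c + Complex.polarCoord.symm (r, θ)) := by
    intro U hU
    rw [← lintegral_indicator measurableSet_ball, ← lintegral_add_left_eq_self _ c,
      ← Complex.lintegral_comp_polarCoord_symm, polarCoord_target, Measure.volume_eq_prod,
      ← Measure.prod_restrict, lintegral_prod]
    · rfl
    · refine Measurable.aemeasurable ?_
      have : Measurable fun p : ℝ × ℝ => Complex.polarCoord.symm p := by
        simp_rw [Complex.polarCoord_symm_apply]; fun_prop
      exact (measurable_fst.ennreal_ofReal).smul
        ((hU.indicator measurableSet_ball).comp (this.const_add c))
  rw [← setLIntegral_const, polar _ measurable_const, polar _ hu.measurable.ennreal_ofReal]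
  refine setLIntegral_mono' measurableSet_Ioi fun r (hr : 0 < r) => ?_
  rw [lintegral_const_mul' _ _ ENNReal.ofReal_ne_top, lintegral_const_mul' _ _ ENNReal.ofReal_ne_top]
  refine mul_le_mul_right ?_ _
  by_cases hrR : r < R
  · have hmem : ∀ θ, c + Complex.polarCoord.symm (r, θ) ∈ ball c R := fun θ =>
      (hball (r, θ) hr).2 hrR
    simp only [Set.indicator_of_mem (hmem _)]
    rw [setLIntegral_const]
    exact ofReal_mul_volume_le_lintegral_arc hu hu0 (h r hr)
  · have hmem : ∀ θ, c + Complex.polarCoord.symm (r, θ) ∉ ball c R := fun θ hθ =>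
      hrR ((hball (r, θ) hr).1 hθ)
    simp only [Set.indicator_of_notMem (hmem _), le_refl]

/-- A quantitative two-constants estimate on a disc, with a set of positive area in place of an arc
of the boundary. -/
theorem posLog_norm_mul_volume_ball_le {f : ℂ → ℂ} (hf : Differentiable ℂ f) {c : ℂ} {R L : ℝ}
    {E : Set ℂ} (hEm : MeasurableSet E) (hE : E ⊆ ball c R) (hE1 : ∀ z ∈ E, ‖f z‖ ≤ 1)
    (hL0 : 0 ≤ L) (hL : ∀ z ∈ ball c R, Real.posLog ‖f z‖ ≤ L) :
    Real.posLog ‖f c‖ * volume.real (ball c R) ≤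
      L * (volume.real (ball c R) - volume.real E) := by
  have h1 := ofReal_mul_volume_ball_le_lintegral (u := fun z => Real.posLog ‖f z‖) (c := c) (R := R)
    (Real.continuous_posLog.comp hf.continuous.norm) (fun _ => Real.posLog_nonneg)
    (fun r hr => posLog_norm_le_circleAverage hf c hr)
  -- `log⁺|f|` vanishes on `E`, so only the complement of `E` contributes.
  have h2 : ∫⁻ z in ball c R, ENNReal.ofReal (Real.posLog ‖f z‖) ≤
      ENNReal.ofReal L * volume (ball c R \ E) := by
    rw [← setLIntegral_const, ← lintegral_indicator measurableSet_ball,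
      ← lintegral_indicator (measurableSet_ball.diff hEm)]
    refine lintegral_mono fun z => ?_
    by_cases hzE : z ∈ E
    · have : Real.posLog ‖f z‖ = 0 := (Real.posLog_eq_zero_iff _).2 (by simpa using hE1 z hzE)
      simp [hE hzE, this]
    · by_cases hz : z ∈ ball c R
      · rw [Set.indicator_of_mem hz, Set.indicator_of_mem (Set.mem_sdiff_of_mem hz hzE)]
        exact ENNReal.ofReal_le_ofReal (hL z hz)
      · simp [Set.indicator_of_notMem hz]
  have h3 := h1.trans h2
  have hfin : volume (ball c R) ≠ ⊤ := measure_ball_lt_top.ne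
  have hfin2 : volume (ball c R \ E) ≠ ⊤ := measure_ne_top_of_subset Set.sdiff_subset hfin
  have h4 := ENNReal.toReal_mono (ENNReal.mul_ne_top ENNReal.ofReal_ne_top hfin2) h3
  rw [ENNReal.toReal_mul, ENNReal.toReal_mul, ENNReal.toReal_ofReal Real.posLog_nonneg,
    ENNReal.toReal_ofReal hL0] at h4
  have h5 := measureReal_sdiff (μ := volume) hE hEm
  rw [← h5]
  exact h4

/-! ### The relation between the orders in `t` and in `z` -/

theorem HasExpGrowth.of_entireOrder_lt {g : ℂ → ℂ} {τ : ℝ≥0} (h : entireOrder g < τ) :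
    HasExpGrowth g τ := by
  obtain ⟨σ, h1, h2⟩ := ENNReal.lt_iff_exists_nnreal_btwn.1 h
  exact entireOrder_le_iff.1 h1.le τ (by exact_mod_cast h2)

theorem HasExpGrowth.hasSeqGrowth {g : ℂ → ℂ} (hg : Differentiable ℂ g) {s : ℝ}
    (h : HasExpGrowth g s) (hs : 0 < s) {γ : ℝ} (hγ : 1 - 1 / s < γ) (c : ℂ) :
    HasSeqGrowth (fun n => iteratedDeriv n g c) γ :=
  (h.norm_iteratedDeriv_le hg hs hγ ‖c‖).mono fun _ hn => hn c le_rfl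

theorem hasSeqGrowth_iteratedDeriv {g : ℂ → ℂ} (hg : Differentiable ℂ g) {γ : ℝ} (hγ : 1 < γ)
    (c : ℂ) : HasSeqGrowth (fun n => iteratedDeriv n g c) γ := by
  obtain ⟨M, hM⟩ := (isCompact_sphere c 1).exists_bound_of_continuousOn hg.continuous.continuousOn
  filter_upwards [eventually_mul_log_add_le M hγ, eventually_gt_atTop 0] with n hn hn0
  have h1 := Complex.norm_iteratedDeriv_le_of_forall_mem_sphere_norm_le (c := c) n one_pos
    hg.diffContOnCl hM
  have hM0 : 0 ≤ M := (norm_nonneg _).trans (hM (c + 1) (by simp))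
  have hn1 : (1 : ℝ) ≤ n := by exact_mod_cast hn0
  rw [one_pow, div_one] at h1
  calc _ ≤ (n.factorial : ℝ) * M := h1
    _ ≤ Real.exp (n * Real.log n) * Real.exp (M * n) := by
      gcongr
      · exact factorial_le_exp hn0
      · have := Real.add_one_le_exp (M * n)
        nlinarith
    _ ≤ _ := by rw [← Real.exp_add]; exact Real.exp_le_exp.2 (by linarith)

namespace IsSepCaloric

variable {F : ℂ → ℂ → ℂ}

theorem hasExpGrowth_t (hF : IsSepCaloric F) {t : ℂ} (z : ℂ) {s s' : ℝ} (hs : 0 < s)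
    (h : HasExpGrowth (F t) s) (hs' : 0 < s') (hss' : 2 - 2 / s < 1 - 1 / s') :
    HasExpGrowth (fun t => F t z) s' ∧ HasExpGrowth (fun t => deriv (F t) z) s' := by
  obtain ⟨γ', h1, h2⟩ := exists_between hss'
  obtain ⟨γ, h3, h4⟩ := exists_between (show 1 - 1 / s < γ' / 2 by
    have : 2 / s = 2 * (1 / s) := by ring
    linarith)
  have hb := h.hasSeqGrowth (hF.diff_z t) hs h3 z
  have hpos : 0 < 1 / s' := by positivity
  have hγ1 : γ' < 1 := by linarith
  have hγ2 : 1 / (1 - γ') < s' := by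
    rw [one_div_lt (by linarith) hs']; linarith
  constructor
  · refine HasSeqGrowth.hasExpGrowth (hF.diff_t z) (c := t) ?_ hγ1 hγ2
    simp_rw [hF.iteratedDeriv_t]
    exact hb.comp_affine two_pos 0 (by push_cast; linarith)
  · refine HasSeqGrowth.hasExpGrowth (hF.deriv_z.diff_t z) (c := t) ?_ hγ1 hγ2
    simp_rw [hF.iteratedDeriv_t_deriv_z]
    exact hb.comp_affine two_pos 1 (by push_cast; linarith)

theorem hasExpGrowth_z_of_hasSeqGrowth (hF : IsSepCaloric F) {t z : ℂ} {γ s : ℝ}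
    (h0 : HasSeqGrowth (fun n => iteratedDeriv (2 * n) (F t) z) γ)
    (h1 : HasSeqGrowth (fun n => iteratedDeriv (2 * n + 1) (F t) z) γ) (hs : 0 < s)
    (hγ : γ < 2 * (1 - 1 / s)) : HasExpGrowth (F t) s := by
  obtain ⟨γ', h3, h4⟩ := exists_between (show γ / 2 < 1 - 1 / s by linarith)
  have hpos : 0 < 1 / s := by positivity
  refine HasSeqGrowth.hasExpGrowth (hF.diff_z t)
    (HasSeqGrowth.of_even_odd (b := fun n => iteratedDeriv n (F t) z) h0 h1
      (γ' := γ') (by linarith)) (by linarith) ?_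
  rw [one_div_lt (by linarith) hs]; linarith

theorem hasExpGrowth_z (hF : IsSepCaloric F) (t : ℂ) {z : ℂ} {s s' : ℝ} (hs' : 0 < s')
    (h0 : HasExpGrowth (fun t => F t z) s') (h1 : HasExpGrowth (fun t => deriv (F t) z) s')
    (hs : 0 < s) (hss' : 1 - 1 / s' < 2 * (1 - 1 / s)) : HasExpGrowth (F t) s := by
  obtain ⟨γ, h3, h4⟩ := exists_between hss'
  refine hF.hasExpGrowth_z_of_hasSeqGrowth (z := z) (γ := γ) ?_ ?_ hs h4
  · simpa only [hF.iteratedDeriv_t] using h0.hasSeqGrowth (hF.diff_t z) hs' h3 t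
  · simpa only [hF.iteratedDeriv_t_deriv_z] using
      h1.hasSeqGrowth (hF.deriv_z.diff_t z) hs' h3 t

/-- The t-derivatives have every exponent above 1 by Cauchy's estimate on a unit circle, and `1 < 2
(1 - 1/s)` exactly when `s > 2`, for positive `s`. -/
theorem zOrder_le_two (hF : IsSepCaloric F) (t : ℂ) : zOrder F t ≤ 2 := by
  refine (entireOrder_le_iff (τ := 2)).2 fun s hs => ?_
  have hs : 2 < s := hs
  have : 1 / s < 1 / 2 := one_div_lt_one_div_of_lt two_pos hs
  obtain ⟨γ, h3, h4⟩ := exists_between (show 1 < 2 * (1 - 1 / s) by linarith)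
  refine hF.hasExpGrowth_z_of_hasSeqGrowth (z := 0) (γ := γ) ?_ ?_ (by linarith) h4
  · simpa only [hF.iteratedDeriv_t] using hasSeqGrowth_iteratedDeriv (hF.diff_t 0) h3 t
  · simpa only [hF.iteratedDeriv_t_deriv_z] using
      hasSeqGrowth_iteratedDeriv (hF.deriv_z.diff_t 0) h3 t

end IsSepCaloric

theorem exists_coe_eq_of_le_two {x : ℝ≥0∞} (hx : x ≤ 2) : ∃ r : ℝ≥0, (r : ℝ≥0∞) = x :=
  ⟨x.toNNReal, ENNReal.coe_toNNReal (ne_top_of_le_ne_top (by simp) hx)⟩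

/-- Clearing the denominator remains valid at `r = 2`, where the quotient is `⊤`. -/
theorem coe_lt_div_two_sub_iff {q r : ℝ≥0} (hr : r ≤ 2) :
    (q : ℝ≥0∞) < r / (2 - r) ↔ (q : ℝ) * (2 - r) < r := by
  have e : (2 : ℝ≥0∞) - r = ((2 - r : ℝ≥0) : ℝ≥0∞) := by simp
  rw [ENNReal.lt_div_iff_mul_lt (Or.inr ENNReal.coe_ne_top) (Or.inl (e ▸ ENNReal.coe_ne_top)), e,
    ← ENNReal.coe_mul, ENNReal.coe_lt_coe, ← NNReal.coe_lt_coe, NNReal.coe_mul, NNReal.coe_sub hr]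
  rfl

theorem div_two_sub_lt_div_two_sub {r₁ r₂ : ℝ≥0} (h : r₁ < r₂) (hr : r₂ ≤ 2) :
    (r₁ : ℝ≥0∞) / (2 - r₁) < r₂ / (2 - r₂) := by
  have h1 : r₁ < 2 := h.trans_le hr
  have h0 : 2 - r₁ ≠ 0 := (tsub_pos_of_lt h1).ne'
  have e : (r₁ : ℝ≥0∞) / (2 - r₁) = ((r₁ / (2 - r₁) : ℝ≥0) : ℝ≥0∞) := by
    rw [ENNReal.coe_div h0]; simp
  rw [e, coe_lt_div_two_sub_iff hr, NNReal.coe_div, NNReal.coe_sub h1.le, div_mul_eq_mul_div,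
    div_lt_iff₀]
  · have : (r₁ : ℝ) < r₂ := h
    push_cast
    linarith
  · have : (r₁ : ℝ) < 2 := h1
    push_cast
    linarith

theorem two_sub_two_div_lt_iff {a b : ℝ} (ha : 0 < a) (hb : 0 < b) :
    2 - 2 / a < 1 - 1 / b ↔ a < b * (2 - a) := by
  rw [← sub_pos, show 1 - 1 / b - (2 - 2 / a) = (b * (2 - a) - a) / (a * b) by field_simp; ring,
    div_pos_iff_of_pos_right (by positivity), sub_pos]

theorem lt_two_sub_two_div_iff {a b : ℝ} (ha : 0 < a) (hb : 0 < b) :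
    1 - 1 / b < 2 - 2 / a ↔ b * (2 - a) < a := by
  rw [← sub_pos, show 2 - 2 / a - (1 - 1 / b) = (a - b * (2 - a)) / (a * b) by field_simp; ring,
    div_pos_iff_of_pos_right (by positivity), sub_pos]

theorem IsSepCaloric.max_tOrder_eq {F : ℂ → ℂ → ℂ} (hF : IsSepCaloric F) (t z : ℂ) :
    max (tOrder₀ F z) (tOrder₁ F z) = zOrder F t / (2 - zOrder F t) := by
  have h2 := hF.zOrder_le_two t
  obtain ⟨r, hr⟩ := exists_coe_eq_of_le_two h2
  rw [← hr] at h2 ⊢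
  have hr2 : r ≤ 2 := by exact_mod_cast h2
  apply le_antisymm
  · by_contra! h
    obtain ⟨q, h1, h3⟩ := ENNReal.lt_iff_exists_nnreal_btwn.1 h
    have h4 := (coe_lt_div_two_sub_iff hr2).not.1 h1.not_gt
    rw [not_lt] at h4
    have hr0 : (0 : ℝ) ≤ r := r.2
    have hq0 : (0 : ℝ) ≤ q := q.2
    have hrlt : (r : ℝ) < 2 := by
      by_contra! hh
      nlinarith
    refine h3.not_ge ?_
    have key : ∀ s' : ℝ, q < s' →
        HasExpGrowth (fun t => F t z) s' ∧ HasExpGrowth (fun t => deriv (F t) z) s' := by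
      intro s' hs'
      have hs0 : 0 < s' := hq0.trans_lt hs'
      -- `2s'/(1 + s')` is the inverse of `s ↦ s/(2 - s)`.
      obtain ⟨s, h5, h6⟩ := exists_between (show (r : ℝ) < 2 * s' / (1 + s') by
        rw [lt_div_iff₀ (by linarith)]; nlinarith)
      rw [lt_div_iff₀ (by linarith)] at h6
      have hs : 0 < s := hr0.trans_lt h5
      exact hF.hasExpGrowth_t z hs (entireOrder_le_iff.1 hr.ge s h5) hs0
        ((two_sub_two_div_lt_iff hs hs0).2 (by linarith))
    exact max_le (entireOrder_le_iff.2 fun s' hs' => (key s' hs').1)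
      (entireOrder_le_iff.2 fun s' hs' => (key s' hs').2)
  · by_contra! h
    obtain ⟨q, h1, h3⟩ := ENNReal.lt_iff_exists_nnreal_btwn.1 h
    rw [coe_lt_div_two_sub_iff hr2] at h3
    have hq : 0 < q := by exact_mod_cast zero_le.trans_lt h1
    have hq0 : (0 : ℝ) < q := hq
    have h4 : zOrder F t ≤ ((2 * q / (1 + q) : ℝ≥0) : ℝ≥0∞) := by
      refine entireOrder_le_iff.2 fun s hs => ?_
      push_cast at hs
      have hs0 : 0 < s := lt_trans (by positivity) hs
      refine hF.hasExpGrowth_z t hq0 (HasExpGrowth.of_entireOrder_lt ((le_max_left _ _).trans_lt h1))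
        (HasExpGrowth.of_entireOrder_lt ((le_max_right _ _).trans_lt h1)) hs0 ?_
      rw [div_lt_iff₀ (by positivity)] at hs
      rw [show 2 * (1 - 1 / s) = 2 - 2 / s by ring, lt_two_sub_two_div_iff hs0 hq0]
      linarith
    rw [← hr, ENNReal.coe_le_coe, ← NNReal.coe_le_coe] at h4
    push_cast at h4
    rw [le_div_iff₀ (by positivity)] at h4
    linarith

theorem IsSepCaloric.zOrder_eq {F : ℂ → ℂ → ℂ} (hF : IsSepCaloric F) (t t' : ℂ) :
    zOrder F t = zOrder F t' := by
  have h := (hF.max_tOrder_eq t 0).symm.trans (hF.max_tOrder_eq t' 0)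
  have h1 := hF.zOrder_le_two t
  have h2 := hF.zOrder_le_two t'
  obtain ⟨r, hr⟩ := exists_coe_eq_of_le_two h1
  obtain ⟨r', hr'⟩ := exists_coe_eq_of_le_two h2
  rw [← hr, ← hr'] at h
  rw [← hr] at h1
  rw [← hr'] at h2
  rw [← hr, ← hr']
  rcases lt_trichotomy r r' with hlt | heq | hlt
  · exact absurd h (div_two_sub_lt_div_two_sub hlt (by exact_mod_cast h2)).ne
  · rw [heq]
  · exact absurd h (div_two_sub_lt_div_two_sub hlt (by exact_mod_cast h1)).ne'

/-! ### Exceptional points have measure zero -/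

/-- If the sequence of entire functions `f n` is of growth exponent `β` locally uniformly, but of
smaller exponent at each point of a set of positive measure, then it is of smaller exponent
uniformly on the unit disc. -/
theorem exists_lt_norm_le_exp_of_volume_ne_zero {f : ℕ → ℂ → ℂ} (hf : ∀ n, Differentiable ℂ (f n))
    {β γ : ℝ} (hβ : ∀ β' > β, ∀ R : ℝ, ∀ᶠ n : ℕ in atTop, ∀ z : ℂ, ‖z‖ ≤ R →
      ‖f n z‖ ≤ Real.exp (β' * (n * Real.log n)))
    (hγ : γ < β) (hpos : volume {z | HasSeqGrowth (fun n => f n z) γ} ≠ 0) :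
    ∃ γ' < β, ∀ᶠ n : ℕ in atTop, ∀ z : ℂ, ‖z‖ ≤ 1 →
      ‖f n z‖ ≤ Real.exp (γ' * (n * Real.log n)) := by
  -- These sets make the threshold in `n` uniform; they cover the given set, so one of them has
  -- positive measure.
  set E : ℕ → Set ℂ := fun N =>
    closedBall 0 N ∩ ⋂ n ∈ Set.Ici N, {z | ‖f n z‖ ≤ Real.exp (γ * (n * Real.log n))} with hEdef
  have hEm : ∀ N, MeasurableSet (E N) := fun N =>
    (isClosed_closedBall.inter (isClosed_biInter fun n _ =>
      isClosed_le (hf n).continuous.norm continuous_const)).measurableSet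
  obtain ⟨N, hN⟩ : ∃ N, volume (E N) ≠ 0 := by
    by_contra! h
    refine hpos (measure_mono_null (fun z hz => ?_) (measure_iUnion_null h))
    obtain ⟨n₀, hn₀⟩ := eventually_atTop.1 hz
    obtain ⟨m, hm⟩ := exists_nat_ge ‖z‖
    refine Set.mem_iUnion.2 ⟨max n₀ m, ?_, ?_⟩
    · rw [mem_closedBall_zero_iff]
      exact hm.trans (by exact_mod_cast le_max_right n₀ m)
    · exact Set.mem_iInter₂.2 fun n hn => hn₀ n ((le_max_left _ _).trans hn)
  -- With this radius every disc centred in the closed unit disc contains `E N`.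
  set R : ℝ := N + 2
  have hR : 0 < R := by positivity
  set V := volume.real (ball (0 : ℂ) R)
  have hVc : ∀ c : ℂ, volume.real (ball c R) = V := fun c => by
    simp only [V, Measure.real, Measure.addHaar_ball_center volume c R]
  have hV : 0 < V := ENNReal.toReal_pos (measure_ball_pos volume 0 hR).ne' measure_ball_lt_top.ne
  have hEsub : ∀ c : ℂ, ‖c‖ ≤ 1 → E N ⊆ ball c R := fun c hc z hz => by
    have h1 : ‖z‖ ≤ N := mem_closedBall_zero_iff.1 hz.1
    rw [mem_ball, dist_eq_norm]
    have := norm_sub_le z c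
    simp only [R]
    linarith
  have hW : 0 < volume.real (E N) := by
    refine ENNReal.toReal_pos hN (measure_ne_top_of_subset (hEsub 0 (by simp)) ?_)
    exact measure_ball_lt_top.ne
  set θ := volume.real (E N) / V with hθdef
  have hθ : 0 < θ := by positivity
  have hθV : volume.real (E N) = θ * V := by rw [hθdef]; field_simp
  have hgap : 0 < θ * (β - γ) := mul_pos hθ (by linarith)
  -- The a priori exponent exceeds `β` by half of `θ (β - γ)`, while the estimate gains `θ (β' -
  -- γ)`, which is at least the whole; the result stays below `β`.
  set β' := β + θ * (β - γ) / 2 with hβ'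
  refine ⟨β' - θ * (β' - γ), by nlinarith, ?_⟩
  filter_upwards [hβ β' (by linarith) (R + 1), eventually_ge_atTop N, eventually_mul_log_pos]
    with n hn hnN hlog z hz
  set l := (n : ℝ) * Real.log n
  have hexp := Real.exp_pos (γ * l)
  have hβγ : γ ≤ β' := by linarith
  have hnorm : ∀ w, ‖((Real.exp (γ * l) : ℝ) : ℂ)⁻¹ * f n w‖ = ‖f n w‖ / Real.exp (γ * l) :=
    fun w => by
      rw [norm_mul, norm_inv, Complex.norm_real, Real.norm_of_nonneg hexp.le, inv_mul_eq_div]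
  -- Division by `exp (γ l)` makes the function at most 1 on `E N`.
  have key := posLog_norm_mul_volume_ball_le (f := fun w => ((Real.exp (γ * l) : ℝ) : ℂ)⁻¹ * f n w)
    ((hf n).const_mul _) (hEm N) (hEsub z hz) (L := (β' - γ) * l) (fun w hw => ?_)
    (by have := sub_nonneg.2 hβγ; positivity) (fun w hw => ?_)
  · rw [hVc, hθV, hnorm] at key
    have h1 : Real.posLog (‖f n z‖ / Real.exp (γ * l)) ≤ (β' - γ) * l * (1 - θ) := by
      refine le_of_mul_le_mul_right ?_ hV
      linarith
    by_cases h0 : ‖f n z‖ = 0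
    · rw [h0]; positivity
    have h2 : Real.log (‖f n z‖ / Real.exp (γ * l)) ≤ (β' - γ) * l * (1 - θ) :=
      (le_max_right _ _).trans h1
    rw [Real.log_div h0 hexp.ne', Real.log_exp] at h2
    rw [← Real.log_le_iff_le_exp (lt_of_le_of_ne (norm_nonneg _) (Ne.symm h0))]
    linarith
  · rw [hnorm, div_le_one hexp]
    exact Set.mem_iInter₂.1 hw.2 n hnN
  · have hw1 : ‖w‖ ≤ R + 1 := by
      rw [mem_ball, dist_eq_norm] at hw
      have := norm_le_norm_add_norm_sub' w z
      linarith
    have h1 : ‖f n w‖ / Real.exp (γ * l) ≤ Real.exp ((β' - γ) * l) := by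
      rw [div_le_iff₀ hexp, ← Real.exp_add]
      refine (hn w hw1).trans_eq ?_
      congr 1; simp only [l]; ring
    rw [hnorm]
    refine (Real.posLog_le_posLog (by positivity) h1).trans ?_
    rw [Real.posLog_apply, Real.log_exp]
    exact max_le (by have := sub_nonneg.2 hβγ; positivity) le_rfl

theorem norm_iteratedDeriv_affine_le {g : ℂ → ℂ} (hg : Differentiable ℂ g) {r : ℝ}
    (hr : 0 < r) (h : ∀ s, r < s → HasExpGrowth g s) {p : ℕ} (hp : 0 < p) (j : ℕ) {β : ℝ}
    (hβ : p * (1 - 1 / r) < β) (R : ℝ) :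
    ∀ᶠ n : ℕ in atTop, ∀ z : ℂ, ‖z‖ ≤ R →
      ‖iteratedDeriv (p * n + j) g z‖ ≤ Real.exp (β * (n * Real.log n)) := by
  have hp' : (0 : ℝ) < p := by exact_mod_cast hp
  obtain ⟨γ, h1, h2⟩ := exists_between (show 1 - 1 / r < β / p by
    rwa [lt_div_iff₀ hp', mul_comm])
  rw [lt_div_iff₀ hp', mul_comm] at h2
  have hlim : Tendsto (fun s : ℝ => 1 - 1 / s) (𝓝[>] r) (𝓝 (1 - 1 / r)) :=
    ((continuousAt_const.sub (continuousAt_const.div continuousAt_id hr.ne')).tendsto).mono_left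
      nhdsWithin_le_nhds
  obtain ⟨s, hs1, hs2⟩ := ((hlim.eventually (gt_mem_nhds h1)).and self_mem_nhdsWithin).exists
  have ht : Tendsto (fun n : ℕ => p * n + j) atTop atTop :=
    tendsto_atTop_mono (fun n => (Nat.le_mul_of_pos_left n hp).trans (Nat.le_add_right _ _))
      tendsto_id
  filter_upwards [ht.eventually ((h s hs2).norm_iteratedDeriv_le hg (hr.trans hs2) hs1 R),
    eventually_mul_log_affine_le hp j h2] with n h3 h4 z hz
  exact (h3 z hz).trans (Real.exp_le_exp.2 h4)

theorem norm_deriv_zero_le_of_unit_ball {g : ℂ → ℂ} (hg : Differentiable ℂ g) {M : ℝ}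
    (h : ∀ z, ‖z‖ ≤ 1 → ‖g z‖ ≤ M) : ‖deriv g 0‖ ≤ M := by
  simpa using Complex.norm_deriv_le_of_forall_mem_sphere_norm_le (c := 0) (R := 1) (C := M)
    one_pos hg.diffContOnCl fun u hu => h u (by simpa using (mem_sphere_zero_iff_norm.1 hu).le)

/-- If the even or the odd `z`-derivatives have a smaller exponent on a set of positive measure
than the order `r` in `z` allows, then the order in `z` is in fact smaller. -/
theorem IsSepCaloric.volume_setOf_hasSeqGrowth_eq_zero {F : ℂ → ℂ → ℂ} (hF : IsSepCaloric F)
    {r : ℝ≥0} (hr0 : 0 < r) (hr : zOrder F 0 = r) {j : ℕ} (hj : j < 2) {γ : ℝ}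
    (hγ : γ < 2 - 2 / (r : ℝ)) :
    volume {z | HasSeqGrowth (fun n => iteratedDeriv (2 * n + j) (F 0) z) γ} = 0 := by
  by_contra hpos
  have hr0' : (0 : ℝ) < r := hr0
  have hd : ∀ n, Differentiable ℂ (iteratedDeriv n (F 0)) :=
    differentiable_iteratedDeriv_complex (hF.diff_z 0)
  obtain ⟨γ', hγ', hbound⟩ := exists_lt_norm_le_exp_of_volume_ne_zero
    (f := fun n => iteratedDeriv (2 * n + j) (F 0)) (fun n => hd _)
    (fun β' hβ' R => norm_iteratedDeriv_affine_le (hF.diff_z 0) hr0'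
      (entireOrder_le_iff.1 hr.le) two_pos j
      (by push_cast; rw [show 2 * (1 - 1 / (r : ℝ)) = 2 - 2 / r by ring]; exact hβ') R) hγ hpos
  obtain ⟨γ₁, h1, h2⟩ := exists_between hγ'
  have hself : HasSeqGrowth (fun n => iteratedDeriv (2 * n + j) (F 0) 0) γ' :=
    hbound.mono fun n hn => hn 0 (by simp)
  -- The bound on the whole disc is essential here: a bound at the single point 0 would say nothing
  -- about the next derivative.
  have hnext : HasSeqGrowth (fun n => iteratedDeriv (2 * n + j + 1) (F 0) 0) γ' :=
    hbound.mono fun n hn => by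
      simp only [iteratedDeriv_succ]; exact norm_deriv_zero_le_of_unit_ball (hd _) hn
  have hmono : ∀ {b : ℕ → ℂ}, HasSeqGrowth b γ' → HasSeqGrowth b γ₁ := fun hb => by
    simpa using hb.comp_affine one_pos 0 (by simpa using h1)
  have heo : HasSeqGrowth (fun n => iteratedDeriv (2 * n) (F 0) 0) γ₁ ∧
      HasSeqGrowth (fun n => iteratedDeriv (2 * n + 1) (F 0) 0) γ₁ := by
    interval_cases j
    · exact ⟨hmono hself, hmono hnext⟩
    -- For `j = 1` the next derivative has order `2n + 2`, the even sequence shifted by one.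
    · exact ⟨HasSeqGrowth.of_succ (b := fun n => iteratedDeriv (2 * n) (F 0) 0) hnext h1,
        hmono hself⟩
  have hlim : Tendsto (fun s : ℝ => 2 * (1 - 1 / s)) (𝓝[<] (r : ℝ)) (𝓝 (2 * (1 - 1 / (r : ℝ)))) :=
    ((continuousAt_const.mul (continuousAt_const.sub
      (continuousAt_const.div continuousAt_id hr0'.ne'))).tendsto).mono_left nhdsWithin_le_nhds
  rw [show 2 - 2 / (r : ℝ) = 2 * (1 - 1 / (r : ℝ)) by ring] at h2
  -- An `s` slightly below `r` still satisfies `γ₁ < 2 (1 - 1/s)`, which forces the z-order down to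
  -- `s`.
  obtain ⟨s, hs, hsr, hs0⟩ := ((hlim.eventually (lt_mem_nhds h2)).and
    ((eventually_mem_nhdsWithin (a := (r : ℝ)) (s := Set.Iio (r : ℝ))).and
      ((lt_mem_nhds hr0').filter_mono nhdsWithin_le_nhds))).exists
  have hsr : s < r := hsr
  have hg := hF.hasExpGrowth_z_of_hasSeqGrowth heo.1 heo.2 hs0 hs
  have hle : zOrder F 0 ≤ (s.toNNReal : ℝ≥0∞) := by
    refine entireOrder_le_iff.2 fun s' hs' => hg.mono ?_
    rw [Real.coe_toNNReal _ hs0.le] at hs'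
    exact hs'.le
  rw [hr, ENNReal.coe_le_coe, ← NNReal.coe_le_coe, Real.coe_toNNReal _ hs0.le] at hle
  exact hle.not_gt hsr

theorem IsSepCaloric.ae_le_entireOrder {F : ℂ → ℂ → ℂ} (hF : IsSepCaloric F) {j : ℕ}
    (hj : j < 2) {G : ℂ → ℂ → ℂ} (hG : ∀ z, Differentiable ℂ (fun t => G t z))
    (hGF : ∀ n z, iteratedDeriv n (fun t => G t z) 0 = iteratedDeriv (2 * n + j) (F 0) z) :
    ∀ᵐ z : ℂ, zOrder F 0 / (2 - zOrder F 0) ≤ entireOrder (fun t => G t z) := by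
  have h2 := hF.zOrder_le_two 0
  obtain ⟨r, hr⟩ := exists_coe_eq_of_le_two h2
  replace hr : zOrder F 0 = (r : ℝ≥0∞) := hr.symm
  rw [hr] at h2 ⊢
  have hr2 : r ≤ 2 := by exact_mod_cast h2
  rcases (zero_le (a := r)).eq_or_lt with rfl | hr0
  · simp
  have hr0' : (0 : ℝ) < r := hr0
  -- The exceptional set is a countable union over rational `q` strictly between the two orders, and
  -- each piece is null.
  have hsub : ∀ q : ℚ, ∀ᵐ z : ℂ, ¬(entireOrder (fun t => G t z) < Real.toNNReal q ∧
      (Real.toNNReal q : ℝ≥0∞) < r / (2 - r)) := by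
    intro q
    by_cases hq : (Real.toNNReal q : ℝ≥0∞) < r / (2 - r)
    swap
    · exact Eventually.of_forall fun z h => hq h.2
    by_cases hq0 : 0 < Real.toNNReal q
    swap
    · refine Eventually.of_forall fun z h => hq0 ?_
      exact_mod_cast zero_le.trans_lt h.1
    obtain ⟨γ, h3, h4⟩ := exists_between
      ((lt_two_sub_two_div_iff hr0' hq0).2 ((coe_lt_div_two_sub_iff hr2).1 hq))
    rw [ae_iff]
    refine measure_mono_null (fun z hz => ?_) (hF.volume_setOf_hasSeqGrowth_eq_zero hr0 hr hj h4)
    have hz := (not_not.1 hz).1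
    have := (HasExpGrowth.of_entireOrder_lt hz).hasSeqGrowth (hG z) hq0 h3 0
    simp_rw [hGF] at this
    exact this
  filter_upwards [ae_all_iff.2 hsub] with z hz
  by_contra! h
  obtain ⟨q, _, h3, h4⟩ := ENNReal.lt_iff_exists_rat_btwn.1 h
  exact hz q ⟨h3, h4⟩

theorem theorem4 (F : ℂ → ℂ → ℂ) (hF : IsEntireCaloric F) :
    ∃ ρ ρt : ℝ≥0∞,
      (∀ t : ℂ, zOrder F t = ρ) ∧
      ρ ≤ 2 ∧
      (∀ z : ℂ, max (tOrder₀ F z) (tOrder₁ F z) = ρt) ∧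
      ρt = ρ / (2 - ρ) ∧
      (ρt = ⊤ ↔ ρ = 2) ∧
      (ρt = 0 ↔ ρ = 0) ∧
      (∀ᵐ z : ℂ, tOrder₀ F z = ρt) ∧
      (∀ᵐ z : ℂ, tOrder₁ F z = ρt) := by
  have hS := hF.isSepCaloric
  have h2 := hS.zOrder_le_two 0
  have hmax := hS.max_tOrder_eq 0
  refine ⟨zOrder F 0, zOrder F 0 / (2 - zOrder F 0), fun t => hS.zOrder_eq t 0, h2, hmax, rfl,
    ?_, ?_, ?_, ?_⟩
  · rw [ENNReal.div_eq_top, tsub_eq_zero_iff_le]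
    constructor
    · rintro (⟨_, h⟩ | ⟨h, _⟩)
      · exact le_antisymm h2 h
      · simp [h] at h2
    · intro h
      simp [h]
  · rw [ENNReal.div_eq_zero_iff]
    exact or_iff_left (ne_top_of_le_ne_top (by simp) tsub_le_self)
  · filter_upwards [hS.ae_le_entireOrder (j := 0) two_pos hS.diff_t
      fun n z => hS.iteratedDeriv_t n 0 z] with z hz
    exact le_antisymm ((le_max_left _ _).trans (hmax z).le) hz
  · filter_upwards [hS.ae_le_entireOrder (j := 1) one_lt_two hS.deriv_z.diff_t
      fun n z => hS.iteratedDeriv_t_deriv_z n 0 z] with z hz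
    exact le_antisymm ((le_max_right _ _).trans (hmax z).le) hz
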